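/- All groups are finite and all representations finite-dimensional. For a group $G$ let $\mathrm{Irr}(G)$ be the set of its complex irreducible characters, $\mathrm{Lin}(G)$ the set of those of degree $1$, and $\langle\varphi,\psi\rangle=\frac1{|G|}\sum_{g\in G}\varphi(g)\overline{\psi(g)}$. A character $\chi$ of $G$ is multiplicity free if $\langle\chi,\mu\rangle\le 1$ for all $\mu\in\mathrm{Irr}(G)$. A group $G$ is pseudo-unramified over a nontrivial abelian normal subgroup $N$ if for every $\mu\in\mathrm{Lin}(N)$ there is $\chi\in\mathrm{Irr}(G)$ with $\langle\chi|_N,\mu\rangle>0$ such that $\chi|_N$ is multiplicity free. Recursively, $G$ is totally pseudo-unramified if it is abelian, or there is a nontrivial abelian normal subgroup $N$ such that $G$ is pseudo-unramified over $N$ and $G/N$ is totally pseudo-unramified. Recursively, a complex representation $\pi$ of $G$ is complete if it decomposes as $\pi=\pi_B\oplus\pi_J$ and there is a nontrivial abelian normal subgroup $N$ of $G$ such that (i) $\pi_B|_N$ is the direct sum of all nontrivial one-dimensional representations of $N$, each with multiplicity $1$; and (ii) $G=N$, or the representation \[Q\pi=\left[\pi\oplus(\pi_B\otimes\pi_B)\oplus(\pi_B\otimes\pi_J)\oplus(\pi_J\otimes\pi_B)\oplus(\pi_B\otimes\pi\otimes\pi_B)\right]_{N^\tau}\]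 of $G/N$ is complete, where $\rho_{N^\tau}$ denotes the part of $\rho$ on which $N$ acts trivially, regarded as a representation of $G/N$. A real representation of $G$ is complete if its complexification is complete. **Theorem.** Let $G$ be a finite group. 1. If $G$ is nontrivial and totally pseudo-unramified, then the regular representation of $G$ (over $\mathbb{C}$, and likewise over $\mathbb{R}$) is complete. 2. If $G$ admits a complete (complex or real) representation, then $G$ is totally pseudo-unramified. 3. If $G$ is nontrivial, then $G$ is totally pseudo-unramified if and only if it admits a complete complex representation, and also if and only if it admits a complete real representation. -/

import Mathlib

universe u v

open scoped TensorProduct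

namespace PseudoUnramified

section Characters

/-- The scalar product `⟨φ, ψ⟩ = |G|⁻¹ ∑_g φ(g) conj(ψ(g))` of complex functions on a finite
group `G`. -/
noncomputable def classInner {G : Type u} [Group G] [Finite G] (φ ψ : G → ℂ) : ℂ :=
  (Nat.card G : ℂ)⁻¹ * ∑ᶠ g : G, φ g * (starRingEnd ℂ) (ψ g)

/-- The set `Irr(G)` of complex irreducible characters of `G`, i.e. the characters of the
irreducible finite-dimensional complex (matrix) representations of `G`. -/
def Irr (G : Type u) [Group G] : Set (G → ℂ) :=
  {χ | ∃ (n : ℕ) (ρ : Representation ℂ G (Fin n → ℂ)), ρ.IsIrreducible ∧ χ = ρ.character}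

/-- The set `Lin(G)` of complex linear characters of `G`: irreducible characters of degree `1`. -/
def Lin (G : Type u) [Group G] : Set (G → ℂ) :=
  {μ | μ ∈ Irr G ∧ μ 1 = 1}

/-- The restriction `χ|_N` of a function on `G` to a subgroup `N`. -/
def res {G : Type u} [Group G] (χ : G → ℂ) (N : Subgroup G) : N → ℂ :=
  fun n => χ n

/-- The set `Irr_μ(G)` of irreducible characters of `G` lying over `μ`, where `μ` is a
character of the subgroup `N`. (The scalar product of two characters is a real number,
namely a natural number.) -/
def IrrOver (G : Type u) [Group G] [Finite G] (N : Subgroup G) (μ : N → ℂ) : Set (G → ℂ) :=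
  {χ | χ ∈ Irr G ∧ 0 < (classInner (res χ N) μ).re}

/-- A complex character `χ` of `G` is multiplicity free if `⟨χ, μ⟩ ≤ 1` for all `μ ∈ Irr(G)`. -/
def MultiplicityFree {G : Type u} [Group G] [Finite G] (χ : G → ℂ) : Prop :=
  ∀ μ ∈ Irr G, (classInner χ μ).re ≤ 1

end Characters

section Groups

/-- `G` is pseudo-unramified over `N`, where `N` is a nontrivial abelian normal subgroup. -/
structure IsPseudoUnramifiedOver (G : Type u) [Group G] [Finite G] (N : Subgroup G) : Prop where
  normal : N.Normal
  nontrivial : N ≠ ⊥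
  abelian : IsMulCommutative N
  exists_over : ∀ μ ∈ Lin N, ∃ χ ∈ IrrOver G N μ, MultiplicityFree (res χ N)

/-- Totally pseudo-unramified finite groups (recursive definition). -/
inductive IsTotallyPseudoUnramified : (G : Type u) → [Group G] → [Finite G] → Prop
  | abelian (G : Type u) [Group G] [Finite G] (h : IsMulCommutative G) :
      IsTotallyPseudoUnramified G
  | step (G : Type u) [Group G] [Finite G] (N : Subgroup G) [N.Normal]
      (hN : IsPseudoUnramifiedOver G N) (hq : IsTotallyPseudoUnramified (G ⧸ N)) :
      IsTotallyPseudoUnramified G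

end Groups

section Representations

/-- The degree one complex representation given by `μ : N →* ℂˣ`. -/
noncomputable def linearRep {N : Type u} [Group N] (μ : N →* ℂˣ) : Representation ℂ N ℂ where
  toFun n := ((μ n : ℂˣ) : ℂ) • LinearMap.id
  map_one' := by ext; simp
  map_mul' a b := by ext; simp [mul_comm]

variable {G : Type u} [Group G] {V : Type v} [AddCommGroup V] [Module ℂ V]

/-- The restriction of a representation of `G` to a subgroup `N`. -/
def restrictRep (π : Representation ℂ G V) (N : Subgroup G) : Representation ℂ N V :=
  π.comp N.subtype

/-- `π|_N` is isomorphic to the direct sum of all nontrivial linear (degree one) representations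
of `N`, each one taken with multiplicity `1`. -/
def ContainsExactlyNontrivialLinear (π : Representation ℂ G V) (N : Subgroup G) : Prop :=
  Nonempty ((restrictRep π N).Equiv
    (Representation.directSum fun μ : {μ : N →* ℂˣ // μ ≠ 1} => linearRep μ.1))

/-- The representation
`π ⊕ (π_B ⊗ π_B) ⊕ (π_B ⊗ π_J) ⊕ (π_J ⊗ π_B) ⊕ (π_B ⊗ π ⊗ π_B)` of `G`, for subrepresentations
`π_B = B` and `π_J = J` of `π`. -/
noncomputable def tensorExpansion (π : Representation ℂ G V) (B J : Subrepresentation π) :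
    Representation ℂ G (V × (B.toSubmodule ⊗[ℂ] B.toSubmodule) ×
      (B.toSubmodule ⊗[ℂ] J.toSubmodule) × (J.toSubmodule ⊗[ℂ] B.toSubmodule) ×
      (B.toSubmodule ⊗[ℂ] (V ⊗[ℂ] B.toSubmodule))) :=
  π.prod ((B.toRepresentation.tprod B.toRepresentation).prod
    ((B.toRepresentation.tprod J.toRepresentation).prod
      ((J.toRepresentation.tprod B.toRepresentation).prod
        (B.toRepresentation.tprod (π.tprod B.toRepresentation)))))

/-- The underlying space of `Qπ`: the part of `tensorExpansion π B J` on which `N` acts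
trivially, i.e. its subspace of `N`-invariants. -/
noncomputable abbrev quotientSpace (π : Representation ℂ G V) (B J : Subrepresentation π)
    (N : Subgroup G) :=
  Representation.invariants ((tensorExpansion π B J).comp N.subtype)

/-- The representation `Qπ` of `G ⧸ N` on the `N`-invariants of `tensorExpansion π B J`. -/
noncomputable abbrev quotientRep (π : Representation ℂ G V) (B J : Subrepresentation π)
    (N : Subgroup G) [N.Normal] : Representation ℂ (G ⧸ N) (quotientSpace π B J N) :=
  (tensorExpansion π B J).quotientToInvariants N

/-- Complete complex representations of finite groups (recursive definition). The decomposition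
`π = π_B ⊕ π_J` is given by complementary subrepresentations `B` and `J`. -/
inductive IsCompleteRep : {G : Type u} → [Group G] → [Finite G] → {V : Type v} → [AddCommGroup V] →
    [Module ℂ V] → Representation ℂ G V → Prop
  | base {G : Type u} [Group G] [Finite G] {V : Type v} [AddCommGroup V] [Module ℂ V]
      (π : Representation ℂ G V) (B J : Subrepresentation π) (N : Subgroup G) [N.Normal]
      (hBJ : IsCompl B J) (hab : IsMulCommutative N) (hnt : N ≠ ⊥)
      (hB : ContainsExactlyNontrivialLinear B.toRepresentation N)
      (hN : N = ⊤) : IsCompleteRep π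
  | step {G : Type u} [Group G] [Finite G] {V : Type v} [AddCommGroup V] [Module ℂ V]
      (π : Representation ℂ G V) (B J : Subrepresentation π) (N : Subgroup G) [N.Normal]
      (hBJ : IsCompl B J) (hab : IsMulCommutative N) (hnt : N ≠ ⊥)
      (hB : ContainsExactlyNontrivialLinear B.toRepresentation N)
      (hQ : IsCompleteRep (V := quotientSpace π B J N) (quotientRep π B J N)) : IsCompleteRep π

end Representations

section Real

variable {G : Type u} [Group G] {V : Type v} [AddCommGroup V] [Module ℝ V]

/-- The complexification of a real representation. -/
noncomputable def complexification (π : Representation ℝ G V) :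
    Representation ℂ G (ℂ ⊗[ℝ] V) where
  toFun g := (π g).baseChange ℂ
  map_one' := by ext; simp
  map_mul' a b := by ext; simp

/-- A real representation of a finite group is complete if its complexification is. -/
def IsCompleteReal [Finite G] (π : Representation ℝ G V) : Prop :=
  IsCompleteRep (complexification π)

end Real

end PseudoUnramified

/-! For one direction, completeness is proved for every representation containing the regular one,
expressed by a vector with linearly independent translates (`HasFreeVector`). Such a representation
contains every irreducible of `G`, so `π_B` can be assembled greedily: as long as a nontrivial `μ`
of `N` is missing, adjoin an irreducible that is multiplicity free over `N` and lies over `μ`. Its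
`N`-characters are all conjugate to `μ`, while those already present form a `G`-stable set without
`μ`; no multiplicity exceeds one and the trivial character never appears
(`exists_subrepresentation_weights`). The `N`-invariants of `π` contain the regular representation
of `G ⧸ N`, and `π` is a summand of the representation defining `Qπ`, so the induction continues;
the tensor terms play no role here.

Conversely, `π_B` restricted to `N` is multiplicity free and contains each nontrivial `μ`. A
smallest representation of `G` that is multiplicity free over `N` and contains `μ` is irreducible by
Maschke (`exists_irreducible_over`); the trivial `μ` is served by the trivial representation.

Multiplicities are handled as ranks of isotypic projections (`classInner_character`). -/

namespace PseudoUnramified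

/-! ### Isotypic projections for linear characters. -/

section Weights

variable {A : Type*} [Group A] {V W : Type*} [AddCommGroup V] [Module ℂ V]
  [AddCommGroup W] [Module ℂ W]

/-- `A` acts on the vector `v` through the linear character `ν`. -/
def IsWeightVector (σ : Representation ℂ A V) (ν : A →* ℂˣ) (v : V) : Prop :=
  ∀ a, σ a v = (ν a : ℂ) • v

variable [Fintype A]

/-- The projection onto the `ν`-isotypic part of a representation of a finite group. -/
noncomputable def weightProj (σ : Representation ℂ A V) (ν : A →* ℂˣ) : V →ₗ[ℂ] V :=
  (Nat.card A : ℂ)⁻¹ • ∑ a, ((ν a⁻¹ : ℂˣ) : ℂ) • σ a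

lemma weightProj_apply (σ : Representation ℂ A V) (ν : A →* ℂˣ) (v : V) :
    weightProj σ ν v = (Nat.card A : ℂ)⁻¹ • ∑ a, ((ν a⁻¹ : ℂˣ) : ℂ) • σ a v := by
  simp [weightProj]

variable (A) in
lemma natCard_ne_zero : (Nat.card A : ℂ) ≠ 0 := Nat.cast_ne_zero.2 Nat.card_pos.ne'

lemma isWeightVector_weightProj (σ : Representation ℂ A V) (ν : A →* ℂˣ) (v : V) :
    IsWeightVector σ ν (weightProj σ ν v) := by
  intro a
  rw [weightProj_apply, map_smul, map_sum, smul_comm ((ν a : ℂˣ) : ℂ),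
    Finset.smul_sum (r := ((ν a : ℂˣ) : ℂ))]
  refine congrArg _ (Fintype.sum_equiv (Equiv.mulLeft a) _ _ fun b => ?_)
  simp only [map_smul, Equiv.coe_mulLeft, map_mul, mul_inv_rev, smul_smul, Module.End.mul_apply]
  congr 1
  simp [mul_comm]

lemma weightProj_eq_smul {σ : Representation ℂ A V} {μ : A →* ℂˣ} (ν : A →* ℂˣ) {v : V}
    (hv : IsWeightVector σ μ v) : ∃ c : ℂ, weightProj σ ν v = c • v := by
  refine ⟨(Nat.card A : ℂ)⁻¹ * ∑ a, ((ν a⁻¹ : ℂˣ) : ℂ) * (μ a : ℂ), ?_⟩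
  rw [weightProj_apply, mul_smul, Finset.sum_smul]
  simp only [hv _, smul_smul]

lemma IsWeightVector.weightProj_eq {σ : Representation ℂ A V} {ν : A →* ℂˣ} {v : V}
    (hv : IsWeightVector σ ν v) : weightProj σ ν v = v := by
  rw [weightProj_apply]
  simp only [hv _, smul_smul, ← Units.val_mul, ← map_mul, inv_mul_cancel, map_one, Units.val_one,
    one_smul, Finset.sum_const, Finset.card_univ, ← Nat.card_eq_fintype_card]
  rw [← Nat.cast_smul_eq_nsmul ℂ, smul_smul, inv_mul_cancel₀ (natCard_ne_zero A), one_smul]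

/-- The projection of `v` is a multiple of `v`, hence has both weights `μ` and `ν`; an element where
they differ forces it to vanish. -/
lemma IsWeightVector.weightProj_eq_zero {σ : Representation ℂ A V} {μ ν : A →* ℂˣ} {v : V}
    (hv : IsWeightVector σ μ v) (h : μ ≠ ν) : weightProj σ ν v = 0 := by
  obtain ⟨c, hc⟩ := weightProj_eq_smul ν hv
  obtain ⟨a, ha⟩ : ∃ a, μ a ≠ ν a := by
    by_contra! H
    exact h (MonoidHom.ext H)
  have h1 := isWeightVector_weightProj σ ν v a
  rw [hc, map_smul, hv a, smul_comm, ← hc, ← sub_eq_zero, ← sub_smul] at h1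
  exact (smul_eq_zero.1 h1).resolve_left (sub_ne_zero.2 fun h => ha (Units.ext h))

lemma map_weightProj (σ : Representation ℂ A V) (τ : Representation ℂ A W) (T : V →ₗ[ℂ] W)
    (hT : ∀ a v, T (σ a v) = τ a (T v)) (ν : A →* ℂˣ) (v : V) :
    T (weightProj σ ν v) = weightProj τ ν (T v) := by
  simp [weightProj_apply, hT]

lemma weightProj_comp_self (σ : Representation ℂ A V) (ν : A →* ℂˣ) :
    IsIdempotentElem (weightProj σ ν) :=
  LinearMap.ext fun v => (isWeightVector_weightProj σ ν v).weightProj_eq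

/-- Linear characters of an abelian group separate points: multiplying by some `μ` with `μ a ≠ 1`
permutes the summands and scales the sum by `μ a`. -/
lemma sum_linearCharacters [IsMulCommutative A] [Fintype (A →* ℂˣ)] (a : A) [Decidable (a = 1)] :
    ∑ ν : A →* ℂˣ, ((ν a : ℂˣ) : ℂ) = if a = 1 then (Nat.card A : ℂ) else 0 := by
  let _ : CommGroup A := { ‹Group A› with mul_comm := mul_comm' }
  split_ifs with h
  · subst h
    simp [← CommGroup.card_monoidHom_of_hasEnoughRootsOfUnity A ℂ, - Nat.card_eq_fintype_card]
    simp
  · obtain ⟨μ, hμ⟩ := CommGroup.exists_apply_ne_one_of_hasEnoughRootsOfUnity A ℂ h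
    have h1 : ∑ ν : A →* ℂˣ, ((ν a : ℂˣ) : ℂ) = (μ a : ℂ) * ∑ ν : A →* ℂˣ, ((ν a : ℂˣ) : ℂ) := by
      rw [Finset.mul_sum]
      refine (Fintype.sum_equiv (Equiv.mulLeft μ) _ _ fun ν => ?_).symm
      simp
    have h2 : ((μ a : ℂ) - 1) * ∑ ν : A →* ℂˣ, ((ν a : ℂˣ) : ℂ) = 0 := by
      rw [sub_mul, ← h1, one_mul, sub_self]
    exact (mul_eq_zero.1 h2).resolve_left (sub_ne_zero.2 fun h => hμ (Units.ext h))

lemma sum_weightProj [IsMulCommutative A] [Fintype (A →* ℂˣ)] (σ : Representation ℂ A V) (v : V) :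
    ∑ ν : A →* ℂˣ, weightProj σ ν v = v := by
  classical
  simp only [weightProj_apply]
  rw [← Finset.smul_sum, Finset.sum_comm]
  simp only [← Finset.sum_smul, sum_linearCharacters, inv_eq_one]
  simp [smul_smul]

lemma conj_linearCharacter (ν : A →* ℂˣ) (a : A) :
    (starRingEnd ℂ) (ν a : ℂ) = ((ν a⁻¹ : ℂˣ) : ℂ) := by
  have h : ‖(ν a : ℂ)‖ = 1 := by
    refine Complex.norm_eq_one_of_pow_eq_one (n := Nat.card A) ?_ Nat.card_pos.ne'
    rw [← Units.val_pow_eq_pow_val, ← map_pow, pow_card_eq_one', map_one, Units.val_one]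
  rw [map_inv, Units.val_inv_eq_inv_val, Complex.inv_eq_conj h]

/-- The scalar product is the trace of `weightProj σ ν`, and the trace of an idempotent is its rank.
-/
lemma classInner_character [FiniteDimensional ℂ V] (σ : Representation ℂ A V) (ν : A →* ℂˣ) :
    classInner σ.character (fun a => (ν a : ℂ)) =
      (Module.finrank ℂ (LinearMap.range (weightProj σ ν)) : ℂ) := by
  rw [← ((LinearMap.isProj_range_iff_isIdempotentElem _).2
    (weightProj_comp_self σ ν)).trace, classInner, finsum_eq_sum_of_fintype, weightProj, map_smul,
    map_sum, smul_eq_mul]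
  simp only [map_smul, conj_linearCharacter, smul_eq_mul, Representation.character, mul_comm]

lemma weightProj_linearRep (μ ν : A →* ℂˣ) [Decidable (μ = ν)] (c : ℂ) :
    weightProj (linearRep μ) ν c = if μ = ν then c else 0 := by
  have h : IsWeightVector (linearRep μ) μ c := fun a => by simp [linearRep]
  split_ifs with hμ
  · subst hμ
    exact h.weightProj_eq
  · exact h.weightProj_eq_zero hμ

variable (A) in
/-- The direct sum of all nontrivial linear characters. -/
noncomputable abbrev nontrivialLinearSum :
    Representation ℂ A (DirectSum {μ : A →* ℂˣ // μ ≠ 1} fun _ => ℂ) :=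
  Representation.directSum fun μ : {μ : A →* ℂˣ // μ ≠ 1} => linearRep μ.1

open Classical in
lemma weightProj_nontrivialLinearSum_apply (ν : A →* ℂˣ)
    (y : DirectSum {μ : A →* ℂˣ // μ ≠ 1} fun _ => ℂ) (κ : {μ : A →* ℂˣ // μ ≠ 1}) :
    weightProj (nontrivialLinearSum A) ν y κ = if κ.1 = ν then y κ else 0 := by
  rw [← weightProj_linearRep]
  exact map_weightProj (nontrivialLinearSum A) (linearRep κ.1) (DirectSum.component ℂ _ _ κ)
    (fun a v => DirectSum.lmap_apply (fun κ : {μ : A →* ℂˣ // μ ≠ 1} => linearRep κ.1 a) v κ) ν y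

lemma weightProj_one_nontrivialLinearSum : weightProj (nontrivialLinearSum A) 1 = 0 := by
  classical
  refine LinearMap.ext fun y => DFinsupp.ext fun κ => ?_
  exact (weightProj_nontrivialLinearSum_apply 1 y κ).trans (if_neg κ.2)

open Classical in
lemma weightProj_nontrivialLinearSum (κ : {μ : A →* ℂˣ // μ ≠ 1})
    (y : DirectSum {μ : A →* ℂˣ // μ ≠ 1} fun _ => ℂ) :
    weightProj (nontrivialLinearSum A) κ.1 y =
      y κ • DirectSum.lof ℂ _ (fun _ : {μ : A →* ℂˣ // μ ≠ 1} => ℂ) κ 1 := by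
  refine DFinsupp.ext fun ι => ?_
  refine (weightProj_nontrivialLinearSum_apply κ.1 y ι).trans ?_
  rw [← map_smul, smul_eq_mul, mul_one]
  split_ifs with h
  · obtain rfl := Subtype.ext h
    exact (DirectSum.of_eq_same (β := fun _ => ℂ) ι (y ι)).symm
  · exact (DirectSum.of_eq_of_ne (β := fun _ => ℂ) κ ι (y κ) fun hc => h (congrArg _ hc)).symm

open Classical in
/-- Intrinsic form of the property that a representation is the sum of all nontrivial linear
characters, each with multiplicity one. -/
theorem nonempty_equiv_nontrivialLinearSum_iff [IsMulCommutative A] (σ : Representation ℂ A V) :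
    Nonempty (σ.Equiv (nontrivialLinearSum A)) ↔
    weightProj σ 1 = 0 ∧ ∀ ν : A →* ℂˣ, ν ≠ 1 → ∃ v ≠ 0, IsWeightVector σ ν v ∧
      ∀ x, weightProj σ ν x ∈ Submodule.span ℂ {v} := by
  constructor
  · rintro ⟨φ⟩
    have hφ : ∀ ν x, φ.toLinearEquiv (weightProj σ ν x) =
        weightProj (nontrivialLinearSum A) ν (φ.toLinearEquiv x) := fun ν x =>
      map_weightProj σ (nontrivialLinearSum A) φ.toLinearEquiv.toLinearMap
        (fun a v => φ.toIntertwiningMap.isIntertwining σ _ a v) ν x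
    refine ⟨LinearMap.ext fun x => φ.toLinearEquiv.injective ?_, fun ν hν => ?_⟩
    · rw [hφ, weightProj_one_nontrivialLinearSum, LinearMap.zero_apply, LinearMap.zero_apply,
        map_zero]
    · set e := DirectSum.lof ℂ _ (fun _ : {μ : A →* ℂˣ // μ ≠ 1} => ℂ) ⟨ν, hν⟩ 1
      have h1 : e ⟨ν, hν⟩ = 1 := DFinsupp.single_eq_same
      have h2 : ∀ x, weightProj σ ν x = (φ.toLinearEquiv x) ⟨ν, hν⟩ • φ.toLinearEquiv.symm e := by
        intro x
        apply φ.toLinearEquiv.injective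
        rw [hφ, map_smul, LinearEquiv.apply_symm_apply]
        exact weightProj_nontrivialLinearSum ⟨ν, hν⟩ _
      refine ⟨φ.toLinearEquiv.symm e, fun h => ?_, ?_, fun x => ?_⟩
      · rw [LinearEquiv.map_eq_zero_iff] at h
        rw [h] at h1
        exact zero_ne_one h1
      · have h3 := h2 (φ.toLinearEquiv.symm e)
        rw [LinearEquiv.apply_symm_apply, h1, one_smul] at h3
        rw [← h3]
        exact isWeightVector_weightProj _ _ _
      · rw [h2]
        exact Submodule.smul_mem _ _ (Submodule.mem_span_singleton_self _)
  · rintro ⟨h1, h⟩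
    choose e he hw hs using h
    let T := DirectSum.toModule ℂ {μ : A →* ℂˣ // μ ≠ 1} V
      (fun μ => LinearMap.toSpanSingleton ℂ V (e μ.1 μ.2))
    have hT1 : ∀ κ c, T (DirectSum.lof ℂ _ (fun _ => ℂ) κ c) = c • e κ.1 κ.2 := fun κ c => by
      simp [T]
    have hT : ∀ a y, T (nontrivialLinearSum A a y) = σ a (T y) := by
      intro a y
      suffices T ∘ₗ nontrivialLinearSum A a = σ a ∘ₗ T from LinearMap.congr_fun this y
      refine DirectSum.linearMap_ext _ fun κ => LinearMap.ext_ring ?_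
      rw [LinearMap.comp_apply, LinearMap.comp_apply, LinearMap.comp_apply, LinearMap.comp_apply,
        hT1, one_smul, hw]
      refine (congrArg T (DirectSum.lmap_lof _ _ _)).trans ?_
      rw [hT1]
      simp [linearRep]
    -- Projecting `T y = 0` to the weight `κ` isolates `y κ • e κ`.
    have hinj : Function.Injective T := by
      rw [injective_iff_map_eq_zero]
      intro y hy
      refine DFinsupp.ext fun κ => ?_
      have h2 := map_weightProj _ _ T hT κ.1 y
      rw [hy, map_zero, weightProj_nontrivialLinearSum, map_smul, hT1, one_smul] at h2
      exact (smul_eq_zero.1 h2).resolve_right (he _ _)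
    have hsurj : Function.Surjective T := by
      have := Fintype.ofFinite (A →* ℂˣ)
      rw [← LinearMap.range_eq_top, eq_top_iff]
      intro x _
      rw [← sum_weightProj σ x]
      refine Submodule.sum_mem _ fun ν _ => ?_
      by_cases hν : ν = 1
      · rw [hν, h1]
        exact Submodule.zero_mem _
      · obtain ⟨c, hc⟩ := Submodule.mem_span_singleton.1 (hs ν hν x)
        exact ⟨_, (hT1 ⟨ν, hν⟩ c).trans hc⟩
    exact ⟨(Representation.Equiv.mk (LinearEquiv.ofBijective T ⟨hinj, hsurj⟩)
      fun a => LinearMap.ext fun y => hT a y).symm⟩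

end Weights
-- Linear characters as irreducible characters.
section LinearCharacters

variable {G : Type u} [Group G]

lemma isIrreducible_of_finrank_eq_one {V : Type*} [AddCommGroup V] [Module ℂ V]
    (ρ : Representation ℂ G V) (h : Module.finrank ℂ V = 1) : ρ.IsIrreducible := by
  have hs : IsSimpleOrder (Submodule ℂ V) :=
    isSimpleModule_iff _ _ |>.1 (isSimpleModule_iff_finrank_eq_one.2 h)
  have : Nontrivial V := Module.nontrivial_of_finrank_pos (R := ℂ) (h ▸ one_pos)
  exact
    { exists_pair_ne := ⟨⊥, ⊤, fun hbt => bot_ne_top (congrArg Subrepresentation.toSubmodule hbt)⟩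
      eq_bot_or_eq_top := fun U => (hs.eq_bot_or_eq_top U.toSubmodule).imp
        (fun h => Subrepresentation.toSubmodule_injective h)
        (fun h => Subrepresentation.toSubmodule_injective h) }

lemma exists_character_eq (μ : G →* ℂˣ) :
    ∃ ρ : Representation ℂ G (Fin 1 → ℂ),
    ρ.IsIrreducible ∧ (∀ v, IsWeightVector ρ μ v) ∧ ρ.character = fun g => (μ g : ℂ) := by
  let ρ : Representation ℂ G (Fin 1 → ℂ) :=
    { toFun := fun g => (μ g : ℂ) • LinearMap.id
      map_one' := by ext; simp
      map_mul' := fun a b => by ext; simp [mul_assoc, mul_left_comm] }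
  refine ⟨ρ, isIrreducible_of_finrank_eq_one ρ (by simp), fun v g => rfl, funext fun g => ?_⟩
  change LinearMap.trace ℂ (Fin 1 → ℂ) ((μ g : ℂ) • LinearMap.id) = _
  rw [map_smul, LinearMap.trace_id]
  simp

lemma coe_mem_Irr (μ : G →* ℂˣ) : (fun g => (μ g : ℂ)) ∈ Irr G := by
  obtain ⟨ρ, h, -, hρ⟩ := exists_character_eq μ
  exact ⟨1, ρ, h, hρ.symm⟩

lemma coe_mem_Lin (μ : G →* ℂˣ) : (fun g => (μ g : ℂ)) ∈ Lin G :=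
  ⟨coe_mem_Irr μ, by simp⟩

lemma exists_eq_coe_of_mem_Irr [Finite G] [IsMulCommutative G] {χ : G → ℂ} (h : χ ∈ Irr G) :
    ∃ μ : G →* ℂˣ, χ = fun g => (μ g : ℂ) := by
  obtain ⟨n, ρ, hρ, rfl⟩ := h
  obtain rfl : n = 1 := by
    have := Representation.IsIrreducible.finrank_eq_one_of_isMulCommutative ρ
    simpa using this
  -- In dimension one the trace equals the determinant, which is multiplicative.
  refine ⟨(LinearMap.det.comp ρ).toHomUnits, funext fun g => ?_⟩
  change LinearMap.trace ℂ _ (ρ g) = LinearMap.det (ρ g)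
  rw [← LinearMap.det_toMatrix', LinearMap.trace_eq_matrix_trace ℂ (Pi.basisFun ℂ (Fin 1)),
    Matrix.det_fin_one, Matrix.trace_fin_one]
  rfl

end LinearCharacters

/-! ### Multiplicities of linear characters of a subgroup. -/

section Restriction

variable {G : Type u} [Group G] (N : Subgroup G) [Fintype N]

/-- The multiplicity of the linear character `ν` of `N` in a representation of `G`. -/
noncomputable def weightMult {V : Type*} [AddCommGroup V] [Module ℂ V]
    (ρ : Representation ℂ G V) (ν : N →* ℂˣ) : ℕ :=
  Module.finrank ℂ (LinearMap.range (weightProj (restrictRep ρ N) ν))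

lemma classInner_res_character [Finite G] {V : Type*} [AddCommGroup V] [Module ℂ V]
    [FiniteDimensional ℂ V] (ρ : Representation ℂ G V) (ν : N →* ℂˣ) :
    classInner (res ρ.character N) (fun a => (ν a : ℂ)) = weightMult N ρ ν :=
  classInner_character (restrictRep ρ N) ν

lemma multiplicityFree_res_character_iff [Finite G] [IsMulCommutative N] {V : Type*}
    [AddCommGroup V] [Module ℂ V] [FiniteDimensional ℂ V] (ρ : Representation ℂ G V) :
    MultiplicityFree (res ρ.character N) ↔ ∀ ν : N →* ℂˣ, weightMult N ρ ν ≤ 1 := by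
  constructor
  · intro h ν
    have := h _ (coe_mem_Irr ν)
    rw [classInner_res_character] at this
    exact_mod_cast this
  · rintro h _ hμ
    obtain ⟨ν, rfl⟩ := exists_eq_coe_of_mem_Irr hμ
    rw [classInner_res_character]
    exact_mod_cast h ν

variable {N}

lemma weightMult_le_of_injective {V W : Type*} [AddCommGroup V] [Module ℂ V] [AddCommGroup W]
    [Module ℂ W] [FiniteDimensional ℂ W] {ρ : Representation ℂ G V} {σ : Representation ℂ G W}
    (T : V →ₗ[ℂ] W) (hT : ∀ g v, T (ρ g v) = σ g (T v)) (hinj : Function.Injective T)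
    (ν : N →* ℂˣ) : weightMult N ρ ν ≤ weightMult N σ ν := by
  rw [weightMult, weightMult, LinearEquiv.finrank_eq (Submodule.equivMapOfInjective T hinj _)]
  refine Submodule.finrank_mono ?_
  rintro _ ⟨_, ⟨x, rfl⟩, rfl⟩
  exact ⟨T x, (map_weightProj (restrictRep ρ N) (restrictRep σ N) T (fun a v => hT a v) ν x).symm⟩

lemma weightMult_pos_iff {V : Type*} [AddCommGroup V] [Module ℂ V] [FiniteDimensional ℂ V]
    {ρ : Representation ℂ G V} {ν : N →* ℂˣ} :
    0 < weightMult N ρ ν ↔ weightProj (restrictRep ρ N) ν ≠ 0 := by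
  rw [weightMult, Nat.pos_iff_ne_zero, Ne, Submodule.finrank_eq_zero, LinearMap.range_eq_bot]

/-- `Irr` is built from matrix representations, so representations on abstract spaces have to be
transported. -/
lemma exists_matrix_representation {V : Type*} [AddCommGroup V] [Module ℂ V]
    [FiniteDimensional ℂ V] (ρ : Representation ℂ G V) :
    ∃ (σ : Representation ℂ G (Fin (Module.finrank ℂ V) → ℂ))
      (e : V ≃ₗ[ℂ] (Fin (Module.finrank ℂ V) → ℂ)), ∀ g v, e (ρ g v) = σ g (e v) := by
  let e := (Module.finBasis ℂ V).equivFun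
  exact ⟨
    { toFun := fun g => e.toLinearMap ∘ₗ ρ g ∘ₗ e.symm.toLinearMap
      map_one' := by ext; simp
      map_mul' := fun a b => by ext; simp }, e, fun g v => by simp⟩

lemma exists_matrix_representation_weightMult {V : Type*} [AddCommGroup V] [Module ℂ V]
    [FiniteDimensional ℂ V] (ρ : Representation ℂ G V) (μ : N →* ℂˣ) (hμ : 0 < weightMult N ρ μ)
    (hρ : ∀ ν : N →* ℂˣ, weightMult N ρ ν ≤ 1) :
    ∃ σ : Representation ℂ G (Fin (Module.finrank ℂ V) → ℂ), 0 < weightMult N σ μ ∧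
      ∀ ν : N →* ℂˣ, weightMult N σ ν ≤ 1 := by
  obtain ⟨σ, e, he⟩ := exists_matrix_representation ρ
  have he' : ∀ g v, e.symm (σ g v) = ρ g (e.symm v) := fun g v => by
    rw [LinearEquiv.symm_apply_eq, he, LinearEquiv.apply_symm_apply]
  exact ⟨σ, hμ.trans_le (weightMult_le_of_injective e.toLinearMap he e.injective μ), fun ν =>
    (weightMult_le_of_injective e.symm.toLinearMap he' e.symm.injective ν).trans (hρ ν)⟩

lemma weightMult_pos_or_of_codisjoint {V : Type*} [AddCommGroup V] [Module ℂ V]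
    [FiniteDimensional ℂ V] (ρ : Representation ℂ G V) (μ : N →* ℂˣ) (hμ : 0 < weightMult N ρ μ)
    (B J : Subrepresentation ρ) (h : Codisjoint B J) :
    0 < weightMult N B.toRepresentation μ ∨ 0 < weightMult N J.toRepresentation μ := by
  by_contra! H
  have hz : ∀ C : Subrepresentation ρ, weightMult N C.toRepresentation μ ≤ 0 →
      ∀ x ∈ C, weightProj (restrictRep ρ N) μ x = 0 := by
    intro C hC x hx
    have h0 : weightProj (restrictRep C.toRepresentation N) μ = 0 := by
      by_contra h0
      exact absurd (weightMult_pos_iff.2 h0) hC.not_gt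
    refine (map_weightProj (restrictRep C.toRepresentation N) (restrictRep ρ N)
      C.toSubmodule.subtype (fun _ _ => rfl) μ ⟨x, hx⟩).symm.trans ?_
    rw [h0, LinearMap.zero_apply, map_zero]
  refine weightMult_pos_iff.1 hμ (LinearMap.ext fun x => ?_)
  have hx : x ∈ B.toSubmodule ⊔ J.toSubmodule := by
    rw [← Subrepresentation.toSubmodule_sup, h.eq_top]
    exact Submodule.mem_top
  obtain ⟨b, hb, j, hj, rfl⟩ := Submodule.mem_sup.1 hx
  rw [map_add, hz B H.1 b hb, hz J H.2 j hj, add_zero, LinearMap.zero_apply]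

/-- A representation in which every linear character of `N` has multiplicity at most one contains,
over each linear character that occurs, an irreducible one with the same property. -/
lemma exists_irreducible_over [Finite G] {V : Type*} [AddCommGroup V] [Module ℂ V]
    [FiniteDimensional ℂ V] (ρ : Representation ℂ G V) (μ : N →* ℂˣ) (hμ : 0 < weightMult N ρ μ)
    (hρ : ∀ ν : N →* ℂˣ, weightMult N ρ ν ≤ 1) :
    ∃ (n : ℕ) (σ : Representation ℂ G (Fin n → ℂ)), σ.IsIrreducible ∧ 0 < weightMult N σ μ ∧
      ∀ ν : N →* ℂˣ, weightMult N σ ν ≤ 1 := by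
  classical
  -- A candidate of least dimension will be irreducible.
  have hex : ∃ m, ∃ σ : Representation ℂ G (Fin m → ℂ), 0 < weightMult N σ μ ∧
      ∀ ν : N →* ℂˣ, weightMult N σ ν ≤ 1 :=
    ⟨_, exists_matrix_representation_weightMult ρ μ hμ hρ⟩
  obtain ⟨σ, h1, h2⟩ := Nat.find_spec hex
  -- A subrepresentation containing `μ` is again a candidate, so minimality makes it everything.
  have hmin : ∀ U : Subrepresentation σ, 0 < weightMult N U.toRepresentation μ → U = ⊤ := by
    intro U hU
    have h3 := Nat.find_le (h := hex) (exists_matrix_representation_weightMult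
      U.toRepresentation μ hU fun ν =>
      (weightMult_le_of_injective U.toSubmodule.subtype (fun _ _ => rfl)
        U.toSubmodule.injective_subtype ν).trans (h2 ν))
    refine Subrepresentation.toSubmodule_injective (Submodule.eq_top_of_finrank_eq ?_)
    refine le_antisymm (Submodule.finrank_le _) ?_
    simpa using h3
  have : NeZero (Nat.card G : ℂ) := ⟨Nat.cast_ne_zero.2 Nat.card_pos.ne'⟩
  refine ⟨_, σ, ?_, h1, h2⟩
  exact
    { exists_pair_ne := by
        refine ⟨⊥, ⊤, fun hbt => weightMult_pos_iff.1 h1 (LinearMap.ext fun x => ?_)⟩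
        have hx : ∀ y, y ∈ (⊥ : Subrepresentation σ) := fun y => hbt ▸ Submodule.mem_top
        exact (Submodule.mem_bot ℂ).1 (hx _)
      eq_bot_or_eq_top := fun U => by
        -- Maschke: `μ` occurs in `U` or in its complement, and whichever contains it is the whole
        -- space.
        obtain ⟨U', hU'⟩ := exists_isCompl U
        rcases weightMult_pos_or_of_codisjoint σ μ h1 U U' hU'.codisjoint with h | h
        · exact Or.inr (hmin U h)
        · left
          have := hU'.inf_eq_bot
          rwa [hmin U' h, inf_top_eq] at this }

end Restriction

/-! ### Complete representations force pseudo-ramification to be trivial at each stage. -/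

section CompleteImpliesPseudoUnramified

variable {G : Type u} [Group G] [Finite G] (N : Subgroup G) [N.Normal] [IsMulCommutative N]

theorem isPseudoUnramifiedOver_of_containsExactlyNontrivialLinear (hN : N ≠ ⊥) {V : Type v}
    [AddCommGroup V] [Module ℂ V] (π : Representation ℂ G V)
    (hπ : ContainsExactlyNontrivialLinear π N) : IsPseudoUnramifiedOver G N where
  normal := inferInstance
  nontrivial := hN
  abelian := inferInstance
  exists_over μ' hμ' := by
    have := Fintype.ofFinite N
    obtain ⟨μ, rfl⟩ := exists_eq_coe_of_mem_Irr hμ'.1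
    suffices ∃ (n : ℕ) (σ : Representation ℂ G (Fin n → ℂ)), σ.IsIrreducible ∧
        0 < weightMult N σ μ ∧ ∀ ν : N →* ℂˣ, weightMult N σ ν ≤ 1 by
      obtain ⟨n, σ, h1, h2, h3⟩ := this
      refine ⟨σ.character, ⟨⟨n, σ, h1, rfl⟩, ?_⟩,
        (multiplicityFree_res_character_iff N σ).2 h3⟩
      rw [classInner_res_character]
      exact_mod_cast h2
    by_cases hμ : μ = 1
    · subst hμ
      -- The trivial character does not occur in `π`; the trivial representation of `G` lies over
      -- it.
      have h0 : IsWeightVector (restrictRep (Representation.trivial ℂ G ℂ) N) 1 (1 : ℂ) :=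
        fun a => by simp [restrictRep]
      refine exists_irreducible_over (Representation.trivial ℂ G ℂ) 1 ?_ fun ν => ?_
      · refine weightMult_pos_iff.2 fun h => one_ne_zero (α := ℂ) ?_
        rw [← h0.weightProj_eq, h, LinearMap.zero_apply]
      · exact (Submodule.finrank_le _).trans (Module.finrank_self ℂ).le
    · obtain ⟨h1, h⟩ := (nonempty_equiv_nontrivialLinearSum_iff (restrictRep π N)).1 hπ
      have : FiniteDimensional ℂ V := by
        classical
        exact Module.Finite.equiv hπ.some.toLinearEquiv.symm
      refine exists_irreducible_over π μ ?_ fun ν => ?_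
      · obtain ⟨v, hv0, hv, -⟩ := h μ hμ
        refine weightMult_pos_iff.2 fun h => hv0 ?_
        rw [← hv.weightProj_eq, h, LinearMap.zero_apply]
      · by_cases hν : ν = 1
        · rw [hν, weightMult, h1, LinearMap.range_zero, finrank_bot]
          exact zero_le_one
        · obtain ⟨v, -, -, hv⟩ := h ν hν
          refine (Submodule.finrank_mono (t := Submodule.span ℂ {v}) ?_).trans
            ((finrank_span_le_card {v}).trans (by simp))
          rintro _ ⟨x, rfl⟩
          exact hv x

theorem IsCompleteRep.isTotallyPseudoUnramified {G : Type u} [Group G] [Finite G] {V : Type v}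
    [AddCommGroup V] [Module ℂ V] {π : Representation ℂ G V} (h : IsCompleteRep π) :
    IsTotallyPseudoUnramified G := by
  induction h with
  | base π B J N hBJ hab hnt hB hN =>
    subst hN
    exact .abelian _ ⟨⟨fun a b => congrArg Subtype.val
      (hab.is_comm.comm ⟨a, Subgroup.mem_top a⟩ ⟨b, Subgroup.mem_top b⟩)⟩⟩
  | step π B J N hBJ hab hnt hB hQ ih =>
    exact .step _ N (isPseudoUnramifiedOver_of_containsExactlyNontrivialLinear N hnt _ hB) ih

end CompleteImpliesPseudoUnramified
-- Representations containing the regular representation.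
section FreeVectors

variable {G : Type u} [Group G]

/-- The representation contains a vector whose translates are linearly independent, i.e. it
contains the regular representation. -/
def HasFreeVector {k : Type*} [Field k] {V : Type*} [AddCommGroup V] [Module k V]
    (π : Representation k G V) : Prop :=
  ∃ v, LinearIndependent k fun g => π g v

variable {V W : Type*} [AddCommGroup V] [Module ℂ V] [AddCommGroup W] [Module ℂ W]

lemma HasFreeVector.prod {π : Representation ℂ G V} (h : HasFreeVector π)
    (σ : Representation ℂ G W) : HasFreeVector (π.prod σ) := by
  obtain ⟨v, hv⟩ := h
  exact ⟨(v, 0), LinearIndependent.of_comp (LinearMap.fst ℂ V W) hv⟩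

/-- The sums of a free orbit over the cosets of `N` are permuted by `G`, depend only on the coset,
and have disjoint supports in the orbit. -/
lemma HasFreeVector.quotientToInvariants [Finite G] {π : Representation ℂ G V}
    (h : HasFreeVector π) (N : Subgroup G) [N.Normal] :
    HasFreeVector (π.quotientToInvariants N) := by
  classical
  have := Fintype.ofFinite G
  obtain ⟨v, hv⟩ := h
  let w (q : G ⧸ N) : V := ∑ g : G, if (g : G ⧸ N) = q then π g v else 0
  have hw : ∀ (g : G) (q : G ⧸ N), π g (w q) = w (g * q) := by
    intro g q
    rw [map_sum]
    refine Fintype.sum_equiv (Equiv.mulLeft g) _ _ fun x => ?_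
    rw [apply_ite (π g), map_zero, Equiv.coe_mulLeft, QuotientGroup.mk_mul, map_mul]
    simp only [mul_right_inj, Module.End.mul_apply]
  refine ⟨⟨w 1, fun n => (hw n 1).trans ?_⟩, ?_⟩
  · rw [(QuotientGroup.eq_one_iff _).2 n.2, one_mul]
  · refine LinearIndependent.of_comp (Submodule.subtype _) ?_
    have hq : ((Submodule.subtype _) ∘ fun q : G ⧸ N => π.quotientToInvariants N q
        ⟨w 1, fun n => (hw n 1).trans (by rw [(QuotientGroup.eq_one_iff _).2 n.2, one_mul])⟩) = w :=
      funext fun q => QuotientGroup.induction_on q fun g => (hw g 1).trans (by rw [mul_one])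
    rw [hq]
    have := Fintype.ofFinite (G ⧸ N)
    rw [Fintype.linearIndependent_iff] at hv ⊢
    intro c hc q
    obtain ⟨g, rfl⟩ := QuotientGroup.mk_surjective q
    -- A relation among coset sums is a relation in the orbit with coefficients constant on cosets.
    refine hv (fun g => c g) ?_ g
    rw [← hc]
    simp only [w, Finset.smul_sum, smul_ite, smul_zero]
    rw [Finset.sum_comm]
    simp

/-- Matrix coefficients `g ↦ (ρ g⁻¹ x) i` embed `ρ` into the span of the orbit of `v`. The
coefficient at `g = 1` is `x i`, so the map is nonzero for a suitable `i`, and irreducibility makes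
it injective. -/
lemma HasFreeVector.exists_injective [Finite G] {π : Representation ℂ G V} (h : HasFreeVector π)
    {n : ℕ} (ρ : Representation ℂ G (Fin n → ℂ)) (hρ : ρ.IsIrreducible) :
    ∃ T : ρ.IntertwiningMap π, Function.Injective T := by
  have := Fintype.ofFinite G
  obtain ⟨v, hv⟩ := h
  obtain ⟨w, i, hwi⟩ : ∃ (w : Fin n → ℂ) (i : Fin n), w i ≠ 0 := by
    by_contra! H
    refine bot_ne_top (α := Subrepresentation ρ) (SetLike.ext fun x => ?_)
    exact iff_of_true ((Submodule.mem_bot ℂ).2 (funext (H x))) Submodule.mem_top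
  let T : ρ.IntertwiningMap π :=
    { toLinearMap := ∑ g : G,
        (LinearMap.toSpanSingleton ℂ V (π g v)) ∘ₗ (LinearMap.proj i) ∘ₗ ρ g⁻¹
      isIntertwining' := fun g => by
        refine LinearMap.ext fun x => ?_
        simp only [LinearMap.comp_apply, LinearMap.sum_apply, map_sum]
        refine (Fintype.sum_equiv (Equiv.mulLeft g) _ _ fun x => ?_).symm
        simp [← Module.End.mul_apply, ← map_mul] }
  have hT : ∀ x, T x = ∑ g : G, (ρ g⁻¹ x) i • π g v := fun x => by
    change (∑ g : G, _ : (Fin n → ℂ) →ₗ[ℂ] V) x = _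
    simp [LinearMap.sum_apply]
  refine ⟨T, (Representation.IsIrreducible.injective_or_eq_zero T).resolve_right fun h0 => hwi ?_⟩
  have h1 := hT w
  rw [h0] at h1
  have h2 := Fintype.linearIndependent_iff.1 hv _ h1.symm 1
  simpa using h2

variable (G) in
/-- The basis of the group algebra given by the group elements. -/
noncomputable def groupBasis (k : Type*) [Field k] : Module.Basis G k (MonoidAlgebra k G) :=
  .ofRepr (MonoidAlgebra.coeffLinearEquiv k)

lemma leftRegular_apply_groupBasis_one (k : Type*) [Field k] (g : G) :
    Representation.leftRegular k G g (groupBasis G k 1) = groupBasis G k g := by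
  have h : ∀ x, groupBasis G k x = MonoidAlgebra.single x 1 := fun x => rfl
  rw [h, h, Representation.ofMulAction_single, smul_eq_mul, mul_one]

lemma hasFreeVector_leftRegular (k : Type*) [Field k] :
    HasFreeVector (Representation.leftRegular k G) :=
  ⟨groupBasis G k 1, by
    simpa only [leftRegular_apply_groupBasis_one] using (groupBasis G k).linearIndependent⟩

lemma hasFreeVector_complexification_leftRegular :
    HasFreeVector (complexification (Representation.leftRegular ℝ G)) := by
  refine ⟨1 ⊗ₜ groupBasis G ℝ 1, ?_⟩
  have h : (fun g => complexification (Representation.leftRegular ℝ G) g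
      (1 ⊗ₜ groupBasis G ℝ 1)) = (groupBasis G ℝ).baseChange ℂ := funext fun g => by
    rw [Module.Basis.baseChange_apply, ← leftRegular_apply_groupBasis_one ℝ g]
    rfl
  rw [h]
  exact Module.Basis.linearIndependent _

end FreeVectors

/-! ### Clifford theory for linear characters of a normal subgroup. -/

section Conjugation

variable {G : Type u} [Group G] {N : Subgroup G} [N.Normal]

/-- The conjugate of a linear character of a normal subgroup. -/
def conjLinear (g : G) (μ : N →* ℂˣ) : N →* ℂˣ :=
  μ.comp (MulAut.conjNormal g⁻¹ : MulAut N).toMonoidHom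

lemma conjLinear_conjLinear_inv (g : G) (μ : N →* ℂˣ) :
    conjLinear g⁻¹ (conjLinear g μ) = μ := by
  ext a
  simp [conjLinear]

lemma eq_one_of_conjLinear_eq_one {g : G} {μ : N →* ℂˣ} (h : conjLinear g μ = 1) : μ = 1 := by
  rw [← conjLinear_conjLinear_inv g μ, h]
  rfl

variable {V : Type*} [AddCommGroup V] [Module ℂ V]

lemma IsWeightVector.conj {π : Representation ℂ G V} {μ : N →* ℂˣ} {v : V}
    (hv : IsWeightVector (restrictRep π N) μ v) (g : G) :
    IsWeightVector (restrictRep π N) (conjLinear g μ) (π g v) := by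
  intro a
  have h := congrArg (π g) (hv (MulAut.conjNormal g⁻¹ a))
  rw [map_smul] at h
  refine Eq.trans ?_ h
  simp [restrictRep, ← Module.End.mul_apply, ← map_mul, mul_assoc]

lemma weightProj_mem {N : Subgroup G} [Fintype N] {π : Representation ℂ G V}
    (B : Subrepresentation π) (ν : N →* ℂˣ) {x : V} (hx : x ∈ B) : weightProj (restrictRep π N) ν x ∈ B := by
  rw [weightProj_apply]
  exact B.toSubmodule.smul_mem _ (B.toSubmodule.sum_mem fun a _ =>
    B.toSubmodule.smul_mem _ (B.apply_mem_toSubmodule _ hx))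

variable [Fintype N]

/-- `g⁻¹` carries a vector of the conjugate weight back to one of weight `μ` inside `B`. -/
lemma weightProj_conjLinear_eq_zero {π : Representation ℂ G V} (B : Subrepresentation π)
    {μ : N →* ℂˣ} (h : ∀ x ∈ B, weightProj (restrictRep π N) μ x = 0) (g : G) {x : V}
    (hx : x ∈ B) : weightProj (restrictRep π N) (conjLinear g μ) x = 0 := by
  have h1 := (isWeightVector_weightProj (restrictRep π N) (conjLinear g μ) x).conj g⁻¹
  rw [conjLinear_conjLinear_inv] at h1
  have h2 := h _ (B.apply_mem_toSubmodule g⁻¹ (weightProj_mem B (conjLinear g μ) hx))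
  rw [h1.weightProj_eq] at h2
  simpa using congrArg (π g) h2

/-- The linear characters of `N` in an irreducible representation of `G` are conjugate. -/
lemma exists_conjLinear_eq {ρ : Representation ℂ G V} (hρ : ρ.IsIrreducible) {μ ν : N →* ℂˣ}
    (hμ : weightProj (restrictRep ρ N) μ ≠ 0) (hν : weightProj (restrictRep ρ N) ν ≠ 0) :
    ∃ g : G, conjLinear g μ = ν := by
  obtain ⟨x, hx⟩ : ∃ x, weightProj (restrictRep ρ N) μ x ≠ 0 := by
    by_contra! H
    exact hμ (LinearMap.ext H)
  set w := weightProj (restrictRep ρ N) μ x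
  have hw' : IsWeightVector (restrictRep ρ N) μ w := isWeightVector_weightProj _ _ _
  -- The translates of one vector of weight `μ` span by irreducibility, and each has a weight
  -- conjugate to `μ`.
  let S : Subrepresentation ρ :=
    { toSubmodule := Submodule.span ℂ (Set.range fun g => ρ g w)
      apply_mem_toSubmodule := fun g y hy => by
        refine Submodule.span_induction ?_ ?_ ?_ ?_ hy
        · rintro _ ⟨h, rfl⟩
          exact Submodule.subset_span ⟨g * h, by simp⟩
        · simp
        · intro a b _ _ ha hb
          rw [map_add]
          exact Submodule.add_mem _ ha hb
        · intro c a _ ha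
          rw [map_smul]
          exact Submodule.smul_mem _ c ha }
  have hS : S.toSubmodule = ⊤ := by
    refine congrArg Subrepresentation.toSubmodule ((eq_bot_or_eq_top S).resolve_left fun h => hx ?_)
    have : w ∈ S := Submodule.subset_span ⟨1, by simp⟩
    rw [h] at this
    exact (Submodule.mem_bot ℂ).1 this
  by_contra! H
  refine hν (LinearMap.ext_on_range hS fun g => ?_)
  exact (hw'.conj g).weightProj_eq_zero (H g)

end Conjugation

/-! ### Construction of `π_B` and the induction over quotients. -/

section PseudoUnramifiedImpliesComplete

variable {G : Type u} [Group G]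

/-- The condition that every nontrivial linear character of `N` lies under an irreducible
representation of `G` in which the multiplicities of linear characters of `N` are at most one. -/
def HasMultiplicityFreeCover (N : Subgroup G) [Fintype N] : Prop :=
  ∀ μ : N →* ℂˣ, μ ≠ 1 → ∃ (n : ℕ) (ρ : Representation ℂ G (Fin n → ℂ)), ρ.IsIrreducible ∧
    0 < weightMult N ρ μ ∧ ∀ ν : N →* ℂˣ, weightMult N ρ ν ≤ 1

lemma hasMultiplicityFreeCover_top [Fintype (⊤ : Subgroup G)] :
    HasMultiplicityFreeCover (⊤ : Subgroup G) := by
  intro μ _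
  obtain ⟨ρ, hρ, hw, -⟩ := exists_character_eq (μ.comp Subgroup.topEquiv.symm.toMonoidHom)
  refine ⟨1, ρ, hρ, weightMult_pos_iff.2 fun h => one_ne_zero (α := Fin 1 → ℂ) ?_, fun ν => ?_⟩
  · have h1 : IsWeightVector (restrictRep ρ ⊤) μ 1 := fun a => hw 1 a
    rw [← h1.weightProj_eq, h, LinearMap.zero_apply]
  · exact (Submodule.finrank_le _).trans (by simp)

variable [Finite G] {N : Subgroup G} [N.Normal] {V : Type*} [AddCommGroup V] [Module ℂ V]

/-- Greedy construction over `S`. Bounding all weights, not only those in `S`, is what lets the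
induction adjoin a whole irreducible at once. -/
lemma exists_subrepresentation_weights [Fintype N] (hN : HasMultiplicityFreeCover N)
    {π : Representation ℂ G V} (hπ : HasFreeVector π) (S : Finset (N →* ℂˣ)) :
    ∃ B : Subrepresentation π, (∀ x ∈ B, weightProj (restrictRep π N) 1 x = 0) ∧
      (∀ ν, ∃ v, ∀ x ∈ B, weightProj (restrictRep π N) ν x ∈ Submodule.span ℂ {v}) ∧
      ∀ μ ∈ S, μ ≠ 1 → ∃ x ∈ B, weightProj (restrictRep π N) μ x ≠ 0 := by
  classical
  induction S using Finset.induction with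
  | empty =>
    have h0 : ∀ ν, ∀ x ∈ (⊥ : Subrepresentation π), weightProj (restrictRep π N) ν x = 0 := by
      intro ν x hx
      rw [(Submodule.mem_bot ℂ).1 hx, map_zero]
    exact ⟨⊥, h0 1, fun ν => ⟨0, fun x hx => by rw [h0 ν x hx]; exact Submodule.zero_mem _⟩, by simp⟩
  | insert μ S hμS ih =>
    obtain ⟨B, hB1, hBm, hBS⟩ := ih
    by_cases hμ : μ ≠ 1 ∧ ∀ x ∈ B, weightProj (restrictRep π N) μ x = 0
    · obtain ⟨hμ1, hμB⟩ := hμ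
      obtain ⟨n, ρ, hρ, hρμ, hρm⟩ := hN μ hμ1
      obtain ⟨T, hT⟩ := hπ.exists_injective ρ hρ
      rw [weightMult_pos_iff] at hρμ
      have hTp : ∀ ν x, T (weightProj (restrictRep ρ N) ν x) =
          weightProj (restrictRep π N) ν (T x) :=
        map_weightProj (restrictRep ρ N) (restrictRep π N) T.toLinearMap
          (fun a x => T.isIntertwining ρ π a x)
      have hsup : ∀ (x : V), x ∈ B ⊔ T.range → ∃ b ∈ B, ∃ y, b + T y = x := by
        intro x hx
        obtain ⟨b, hb, _, ⟨y, rfl⟩, rfl⟩ := Submodule.mem_sup.1 hx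
        exact ⟨b, hb, y, rfl⟩
      have hle : B ≤ B ⊔ T.range := le_sup_left
      refine ⟨B ⊔ T.range, fun x hx => ?_, fun ν => ?_, fun ν hν hν1 => ?_⟩
      · obtain ⟨b, hb, y, rfl⟩ := hsup x hx
        -- The trivial character is conjugate only to itself, and `μ ≠ 1`.
        have h1 : weightProj (restrictRep ρ N) 1 = 0 := by
          by_contra h1
          obtain ⟨g, hg⟩ := exists_conjLinear_eq hρ hρμ h1
          exact hμ1 (eq_one_of_conjLinear_eq_one hg)
        rw [map_add, hB1 b hb, ← hTp, h1, LinearMap.zero_apply, map_zero, add_zero]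
      · by_cases hν : weightProj (restrictRep ρ N) ν = 0
        · obtain ⟨v, hv⟩ := hBm ν
          refine ⟨v, fun x hx => ?_⟩
          obtain ⟨b, hb, y, rfl⟩ := hsup x hx
          rw [map_add, ← hTp, hν, LinearMap.zero_apply, map_zero, add_zero]
          exact hv b hb
        -- Here `ν` is conjugate to `μ`, so it is absent from `B` and only `ρ` contributes.
        · obtain ⟨g, rfl⟩ := exists_conjLinear_eq hρ hρμ hν
          obtain ⟨v, hv⟩ := finrank_le_one_iff.1 (hρm (conjLinear g μ))
          refine ⟨T v, fun x hx => ?_⟩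
          obtain ⟨b, hb, y, rfl⟩ := hsup x hx
          obtain ⟨c, hc⟩ := hv ⟨_, y, rfl⟩
          rw [map_add, weightProj_conjLinear_eq_zero B hμB g hb, zero_add, ← hTp,
            Submodule.mem_span_singleton]
          exact ⟨c, by rw [← map_smul]; exact congrArg T (congrArg Subtype.val hc)⟩
      · rcases Finset.mem_insert.1 hν with rfl | hν
        · obtain ⟨y, hy⟩ : ∃ y, weightProj (restrictRep ρ N) ν y ≠ 0 := by
            by_contra! H
            exact hρμ (LinearMap.ext H)
          refine ⟨T y, Submodule.mem_sup_right ⟨y, rfl⟩, ?_⟩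
          rw [← hTp]
          exact fun h => hy (hT (h.trans (map_zero T).symm))
        · obtain ⟨x, hx, hx0⟩ := hBS ν hν hν1
          exact ⟨x, hle hx, hx0⟩
    · refine ⟨B, hB1, hBm, fun ν hν hν1 => ?_⟩
      rcases Finset.mem_insert.1 hν with rfl | hν
      · by_contra! H
        exact hμ ⟨hν1, H⟩
      · exact hBS ν hν hν1

lemma exists_containsExactlyNontrivialLinear [Fintype N] [IsMulCommutative N]
    (hN : HasMultiplicityFreeCover N) {π : Representation ℂ G V} (hπ : HasFreeVector π) :
    ∃ B : Subrepresentation π, ContainsExactlyNontrivialLinear B.toRepresentation N := by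
  have := Fintype.ofFinite (N →* ℂˣ)
  obtain ⟨B, hB1, hBm, hBS⟩ := exists_subrepresentation_weights hN hπ Finset.univ
  have hp : ∀ ν (x : B.toSubmodule), (weightProj (restrictRep B.toRepresentation N) ν x : V) =
      weightProj (restrictRep π N) ν x :=
    map_weightProj (restrictRep B.toRepresentation N) (restrictRep π N) B.toSubmodule.subtype
      (fun _ _ => rfl)
  refine ⟨B, (nonempty_equiv_nontrivialLinearSum_iff (restrictRep B.toRepresentation N)).2
    ⟨LinearMap.ext fun x => Subtype.ext ((hp 1 x).trans (hB1 x x.2)), fun ν hν => ?_⟩⟩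
  obtain ⟨x, hx, hx0⟩ := hBS ν (Finset.mem_univ _) hν
  obtain ⟨v, hv⟩ := hBm ν
  -- The spanning vector `v` is only known to lie in `V`; a nonzero projection inside `B` replaces
  -- it.
  refine ⟨weightProj (restrictRep B.toRepresentation N) ν ⟨x, hx⟩, fun h => hx0 ?_,
    isWeightVector_weightProj _ _ _, fun y => ?_⟩
  · exact (hp ν ⟨x, hx⟩).symm.trans (congrArg Subtype.val h)
  · obtain ⟨c, hc⟩ := Submodule.mem_span_singleton.1 (hv x hx)
    obtain ⟨d, hd⟩ := Submodule.mem_span_singleton.1 (hv y y.2)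
    have hc0 : c ≠ 0 := by
      rintro rfl
      exact hx0 (by rw [← hc, zero_smul])
    refine Submodule.mem_span_singleton.2 ⟨d * c⁻¹, Subtype.ext ?_⟩
    rw [Submodule.coe_smul, hp, hp, ← hd]
    change (d * c⁻¹) • weightProj (restrictRep π N) ν x = d • v
    rw [← hc, smul_smul, mul_assoc, inv_mul_cancel₀ hc0, mul_one]

lemma IsPseudoUnramifiedOver.hasMultiplicityFreeCover {N : Subgroup G} [Fintype N]
    (hN : IsPseudoUnramifiedOver G N) : HasMultiplicityFreeCover N := by
  intro μ _
  have := hN.abelian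
  obtain ⟨_, ⟨⟨n, ρ, hρ, rfl⟩, h1⟩, h2⟩ := hN.exists_over _ (coe_mem_Lin μ)
  rw [classInner_res_character] at h1
  exact ⟨n, ρ, hρ, by exact_mod_cast h1, (multiplicityFree_res_character_iff N ρ).1 h2⟩

/-- The regular representation is replaced by any `π` with a free vector because this property,
unlike being regular, is inherited by `Qπ`. -/
theorem IsTotallyPseudoUnramified.isCompleteRep {G : Type u} [Group G] [Finite G]
    (hG : IsTotallyPseudoUnramified G) (hn : Nontrivial G) {V : Type v} [AddCommGroup V] [Module ℂ V]
    {π : Representation ℂ G V} (hπ : HasFreeVector π) : IsCompleteRep π := by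
  induction hG generalizing V with
  | abelian G h =>
    have := Fintype.ofFinite (⊤ : Subgroup G)
    have : NeZero (Nat.card G : ℂ) := ⟨Nat.cast_ne_zero.2 Nat.card_pos.ne'⟩
    obtain ⟨B, hB⟩ := exists_containsExactlyNontrivialLinear hasMultiplicityFreeCover_top hπ
    obtain ⟨J, hJ⟩ := exists_isCompl B
    have : Nontrivial (Subgroup G) := Subgroup.nontrivial_iff.2 hn
    exact .base π B J ⊤ hJ inferInstance top_ne_bot hB rfl
  | step G N hN hq ih =>
    have := Fintype.ofFinite N
    have : NeZero (Nat.card G : ℂ) := ⟨Nat.cast_ne_zero.2 Nat.card_pos.ne'⟩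
    have := hN.abelian
    obtain ⟨B, hB⟩ := exists_containsExactlyNontrivialLinear hN.hasMultiplicityFreeCover hπ
    obtain ⟨J, hJ⟩ := exists_isCompl B
    -- If `N = ⊤`, the quotient is trivial and has no complete representation, so the recursion must
    -- stop here.
    by_cases htop : N = ⊤
    · exact .base π B J N hJ this hN.nontrivial hB htop
    · exact .step π B J N hJ hN.abelian hN.nontrivial hB
        (ih (QuotientGroup.nontrivial_iff.2 htop) ((hπ.prod _).quotientToInvariants N))

end PseudoUnramifiedImpliesComplete
end PseudoUnramified

theorem mainTheorem5 (G : Type u) [Group G] [Finite G] :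
    -- (1) the (complex, respectively real) regular representation is complete
    (Nontrivial G → PseudoUnramified.IsTotallyPseudoUnramified G →
      PseudoUnramified.IsCompleteRep (Representation.leftRegular ℂ G) ∧
      PseudoUnramified.IsCompleteReal (Representation.leftRegular ℝ G)) ∧
    -- (2) a group with a complete (complex or real) representation is totally pseudo-unramified
    ((∀ (V : Type v) [AddCommGroup V] [Module ℂ V] [FiniteDimensional ℂ V]
        (π : Representation ℂ G V),
        PseudoUnramified.IsCompleteRep π → PseudoUnramified.IsTotallyPseudoUnramified G) ∧
      (∀ (V : Type v) [AddCommGroup V] [Module ℝ V] [FiniteDimensional ℝ V]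
        (π : Representation ℝ G V),
        PseudoUnramified.IsCompleteReal π → PseudoUnramified.IsTotallyPseudoUnramified G)) ∧
    -- (3) the resulting characterisation
    (Nontrivial G →
      (PseudoUnramified.IsTotallyPseudoUnramified G ↔
        ∃ (V : Type u) (_ : AddCommGroup V) (_ : Module ℂ V) (_ : FiniteDimensional ℂ V)
          (π : Representation ℂ G V), PseudoUnramified.IsCompleteRep π) ∧
      (PseudoUnramified.IsTotallyPseudoUnramified G ↔
        ∃ (V : Type u) (_ : AddCommGroup V) (_ : Module ℝ V) (_ : FiniteDimensional ℝ V)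
          (π : Representation ℝ G V), PseudoUnramified.IsCompleteReal π)) := by
  have h1 (hn : Nontrivial G) (h : PseudoUnramified.IsTotallyPseudoUnramified G) :=
    h.isCompleteRep hn (PseudoUnramified.hasFreeVector_leftRegular ℂ)
  have h2 (hn : Nontrivial G) (h : PseudoUnramified.IsTotallyPseudoUnramified G) :
      PseudoUnramified.IsCompleteReal (Representation.leftRegular ℝ G) :=
    h.isCompleteRep hn PseudoUnramified.hasFreeVector_complexification_leftRegular
  refine ⟨fun hn h => ⟨h1 hn h, h2 hn h⟩,
    ⟨fun V _ _ _ π h => h.isTotallyPseudoUnramified,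
      fun V _ _ _ π h => PseudoUnramified.IsCompleteRep.isTotallyPseudoUnramified h⟩,
    fun hn => ⟨⟨fun h => ?_, ?_⟩, ⟨fun h => ?_, ?_⟩⟩⟩
  · exact ⟨MonoidAlgebra ℂ G, _, _, .of_basis (PseudoUnramified.groupBasis G ℂ), _, h1 hn h⟩
  · rintro ⟨V, _, _, _, π, h⟩
    exact h.isTotallyPseudoUnramified
  · exact ⟨MonoidAlgebra ℝ G, _, _, .of_basis (PseudoUnramified.groupBasis G ℝ), _, h2 hn h⟩
  · rintro ⟨V, _, _, _, π, h⟩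
    exact PseudoUnramified.IsCompleteRep.isTotallyPseudoUnramified h
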